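/- Let $\mathcal H$ be the upper half plane and $\mathrm{Mer}$ the algebra of meromorphic functions on $\mathcal H$. Write $f'=\frac1{2\pi i}\frac{df}{dz}$ and, for $k\in\mathbb R$, $D_kf=f'-\frac{k}{12}E_2f$, where $E_2=1-24q-\cdots$ is the Eisenstein series of weight $2$. Let $M=\bigoplus_{k\in\mathbb R}M_k$ with $M_k=\mathrm{Mer}$, where $(f,k)$ denotes the element $f$ of $M_k$; it is a graded commutative $\mathbb C$-algebra by $(f,k)(g,l)=(fg,k+l)$. Let $\delta$ be the linear endomorphism of $M$ with $\delta(f,k)=(D_kf,k+2)$. Let $\mathcal M=\bigoplus_{n\in2\mathbb Z}\mathcal M_n\subset M$ be the graded ring of holomorphic modular forms on $\mathrm{SL}(2,\mathbb Z)$, and let $\overline{\mathcal M}\subset M$ be the graded ring of meromorphic modular forms, that is, of the quotients $f/g$ with $f\in\mathcal M$ and $g\in\mathcal M$ homogeneous and nonzero; $\overline{\mathcal M}_k=\overline{\mathcal M}\cap M_k$. Let $\overline{\mathcal R}$ be the algebra of endomorphisms of $M$ generated by $\delta$ and the multiplications by elements of $\overline{\mathcal M}$ (the meromorphic modular linear differential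 operators, meromorphic MLDOs), and let $\overline{\mathcal R}_k$ be the set of those $a\in\overline{\mathcal R}$ with $a(M_l)\subset M_{l+k}$ for all $l\in\mathbb R$. For an integer $n\ge0$ let $\overline{\mathcal R}^n$ be the set of meromorphic MLDOs of order $n$, i.e. of the form $\sum_{i=0}^n c_i\delta^i$ with $c_i\in\overline{\mathcal M}$ and $c_n\ne0$. For $k\in\mathbb R$ put $$\overline S^n_k=\{\phi\in M_k\mid a\phi=0\text{ for some }a\in\overline{\mathcal R}^n\},$$ the set of solutions of weight $k$ of (not necessarily monic) modular linear differential equations of order $n$. Then for all integers $n,m\ge0$ and all $k,l\in\mathbb R$: 1. $\overline S^n_k+\overline S^m_k\subset\overline S^{n+m}_k$, i.e. $\phi+\psi\in\overline S^{n+m}_k$ for all $\phi\in\overline S^n_k$ and $\psi\in\overline S^m_k$; 2. $\overline S^n_k\,\overline S^m_l\subset\overline S^{nm}_{k+l}$, i.e. $\phi\psi\in\overline S^{nm}_{k+l}$ for all $\phi\in\overline S^n_k$ and $\psi\in\overline S^m_l$; 3. $\overline{\mathcal R}_k\,\overline S^m_l\subset\overline S^m_{k+l}$, i.e. $a\phi\in\overline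 S^m_{k+l}$ for all $a\in\overline{\mathcal R}_k$ and $\phi\in\overline S^m_l$; 4. $\overline{\mathcal M}_k\subset\overline S^1_k$. -/

import Mathlib

open scoped Pointwise MatrixGroups Manifold

noncomputable section

namespace MLDO

open UpperHalfPlane Filter

/-! ### Meromorphic functions on the upper half plane -/

/-- Functions `ℂ → ℂ` that are meromorphic at every point of the upper half plane. Their values off
the upper half plane and on discrete closed subsets of it are irrelevant and are divided out in
`Mer`. -/
def merFun : Subalgebra ℂ (ℂ → ℂ) where
  carrier := {f | MeromorphicOn f upperHalfPlaneSet}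
  mul_mem' hf hg := MeromorphicOn.mul hf hg
  add_mem' hf hg := MeromorphicOn.add hf hg
  algebraMap_mem' c := MeromorphicOn.const c

/-- The functions that vanish on the upper half plane outside a discrete closed subset of it. -/
def nullFun : Ideal merFun where
  carrier := {f | (f : ℂ → ℂ) =ᶠ[codiscreteWithin upperHalfPlaneSet] 0}
  add_mem' {f g} hf hg := by
    rw [Set.mem_ofPred_eq] at hf hg ⊢
    filter_upwards [hf, hg] with z h1 h2
    simp [h1, h2]
  zero_mem' := by
    rw [Set.mem_ofPred_eq]
    exact EventuallyEq.rfl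
  smul_mem' c f hf := by
    rw [Set.mem_ofPred_eq] at hf ⊢
    filter_upwards [hf] with z h
    simp [h]

theorem mem_nullFun {f : merFun} :
    f ∈ nullFun ↔ (f : ℂ → ℂ) =ᶠ[codiscreteWithin upperHalfPlaneSet] 0 := Iff.rfl

/-- `Mer`: the `ℂ`-algebra of meromorphic functions on the upper half plane. -/
abbrev Mer : Type := merFun ⧸ nullFun

/-- The class in `Mer` of a function that is meromorphic on the upper half plane. -/
abbrev Mer.mk (f : merFun) : Mer := Ideal.Quotient.mk nullFun f

theorem Mer.mk_eq_mk {f g : merFun} : Mer.mk f = Mer.mk g ↔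
    (f : ℂ → ℂ) =ᶠ[codiscreteWithin upperHalfPlaneSet] (g : ℂ → ℂ) := by
  rw [Ideal.Quotient.eq, mem_nullFun]
  exact (eventuallyEq_iff_sub (f := (f : ℂ → ℂ)) (g := (g : ℂ → ℂ))).symm

/-- A holomorphic function on the upper half plane, as an element of `Mer`. -/
def Mer.ofHol (f : ℍ → ℂ) (hf : MDiff f) : Mer :=
  Mer.mk ⟨f ∘ ofComplex, fun _ hz =>
    ((UpperHalfPlane.mdifferentiable_iff.mp hf).analyticAt (isOpen_upperHalfPlaneSet.mem_nhds hz)).meromorphicAt⟩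

/-- The derivative `f ↦ f' = (2πi)⁻¹ df/dz` on functions. -/
def derivFun (f : merFun) : merFun :=
  ⟨(2 * Real.pi * Complex.I : ℂ)⁻¹ • deriv (f : ℂ → ℂ), merFun.smul_mem (MeromorphicOn.deriv f.2) _⟩

theorem derivFun_congr {f g : merFun} (h : Mer.mk f = Mer.mk g) :
    Mer.mk (derivFun f) = Mer.mk (derivFun g) := by
  rw [Mer.mk_eq_mk] at h ⊢
  filter_upwards [MeromorphicOn.deriv_eventuallyEq_codiscreteWithin f.2 g.2 h] with z hz
  simp [derivFun, hz]

theorem deriv_ae (f : merFun) :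
    ∀ᶠ z in codiscreteWithin upperHalfPlaneSet, DifferentiableAt ℂ (f : ℂ → ℂ) z :=
  (MeromorphicOn.eventually_codiscreteWithin_analyticAt (f : ℂ → ℂ) f.2).mono
    fun _ h => h.differentiableAt

/-- The derivative `f ↦ f' = (2πi)⁻¹ df/dz` of meromorphic functions on the upper half plane. -/
def Mer.deriv : Mer →ₗ[ℂ] Mer where
  toFun := Quotient.lift (fun f => Mer.mk (derivFun f)) fun _ _ h =>
    derivFun_congr (Quotient.sound h)
  map_add' x y := by
    obtain ⟨f, rfl⟩ := Ideal.Quotient.mk_surjective x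
    obtain ⟨g, rfl⟩ := Ideal.Quotient.mk_surjective y
    change Mer.mk (derivFun (f + g)) = Mer.mk (derivFun f + derivFun g)
    rw [Mer.mk_eq_mk]
    filter_upwards [deriv_ae f, deriv_ae g] with z hf hg
    simp [derivFun, deriv_add hf hg, mul_add, add_comm]
  map_smul' c x := by
    obtain ⟨f, rfl⟩ := Ideal.Quotient.mk_surjective x
    change Mer.mk (derivFun (c • f)) = Mer.mk (c • derivFun f)
    rw [Mer.mk_eq_mk]
    filter_upwards [deriv_ae f] with z hf
    simp [derivFun, deriv_const_smul c hf, mul_left_comm]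

/-- The Eisenstein series `E₂ = 1 - 24 q - ⋯` as an element of `Mer`. -/
def Mer.E2 : Mer := Mer.ofHol EisensteinSeries.E2 E2_mdifferentiable

/-- The Ramanujan–Serre operator `D_k f = f' - (k / 12) E₂ f` on `Mer`, for `k` real. -/
def Mer.serre (k : ℝ) : Mer →ₗ[ℂ] Mer :=
  Mer.deriv - ((k : ℂ) / 12) • LinearMap.mulLeft ℂ Mer.E2

/-! ### The graded algebra `M` and the operator `δ` -/

/-- `M = ⨁_{k ∈ ℝ} M_k` with `M_k = Mer`: the element `(f, k)` of `M_k` is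
`AddMonoidAlgebra.single k f`, and `(f, k) (g, l) = (f g, k + l)`. -/
abbrev M : Type := AddMonoidAlgebra Mer ℝ

/-- The element `(f, k)` of `M_k`. -/
abbrev wt (f : Mer) (k : ℝ) : M := AddMonoidAlgebra.single k f

/-- The homogeneous component `M_k` as a subset of `M`. -/
def homog (k : ℝ) : Set M := {φ | ∃ f : Mer, φ = wt f k}

/-- The operator `δ` on `M`, determined by `δ (f, k) = (D_k f, k + 2)`. -/
def delta : Module.End ℂ M where
  toFun φ := φ.coeff.sum fun k f => wt (Mer.serre k f) (k + 2)
  map_add' φ ψ := by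
    rw [AddMonoidAlgebra.coeff_add, Finsupp.sum_add_index'] <;> simp
  map_smul' c φ := by
    rw [AddMonoidAlgebra.coeff_smul, Finsupp.sum_smul_index' (by simp)]
    simp [Finsupp.smul_sum]

theorem delta_wt (f : Mer) (k : ℝ) : delta (wt f k) = wt (Mer.serre k f) (k + 2) := by
  simp [delta]

/-! ### Meromorphic modular forms -/

/-- `𝓜 = ⨁_{n ∈ 2ℤ} 𝓜_n`, the holomorphic modular forms on `SL(2, ℤ)`, inside `M`. -/
def modForms : Submodule ℂ M :=
  Submodule.span ℂ {φ | ∃ n : ℤ, Even n ∧ ∃ f : ModularForm 𝒮ℒ n,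
    φ = wt (Mer.ofHol f f.holo') n}

/-- The meromorphic modular forms: the quotients `f / g` in `M` with `f ∈ 𝓜` and `g` a nonzero
homogeneous element of `𝓜`. -/
def merForms : Set M :=
  {φ | ∃ f ∈ modForms, ∃ g ∈ modForms, (∃ n : ℝ, g ∈ homog n) ∧ g ≠ 0 ∧ φ * g = f}

/-- The meromorphic modular forms of weight `k`. -/
def merFormsWt (k : ℝ) : Set M := merForms ∩ homog k

/-! ### Meromorphic modular linear differential operators -/

/-- The algebra of meromorphic MLDOs: the subalgebra of `End M` generated by `δ` and by the
multiplications by meromorphic modular forms. -/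
def merMLDO : Subalgebra ℂ (Module.End ℂ M) :=
  Algebra.adjoin ℂ ({delta} ∪ LinearMap.mulLeft ℂ '' merForms)

/-- The meromorphic MLDOs of weight `k`: those that map `M_l` into `M_{l + k}` for every `l`. -/
def merMLDOWt (k : ℝ) : Set (Module.End ℂ M) :=
  {a | a ∈ merMLDO ∧ ∀ l, ∀ φ ∈ homog l, a φ ∈ homog (l + k)}

/-- The meromorphic MLDOs of order (exactly) `n`: those of the form `∑_{i ≤ n} c_i δ^i` with
meromorphic modular forms `c_i` and `c_n ≠ 0`. -/
def merMLDOOrd (n : ℕ) : Set (Module.End ℂ M) :=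
  {a | a ∈ merMLDO ∧ ∃ c : ℕ → M, (∀ i, c i ∈ merForms) ∧ c n ≠ 0 ∧
    a = ∑ i ∈ Finset.range (n + 1), LinearMap.mulLeft ℂ (c i) * delta ^ i}

/-- The set of solutions of weight `k` to (not necessarily monic) MLDEs of order `n`: the elements
of `M_k` that are annihilated by some meromorphic MLDO of order `n`. -/
def sol (n : ℕ) (k : ℝ) : Set M := {φ | φ ∈ homog k ∧ ∃ a ∈ merMLDOOrd n, a φ = 0}

end MLDO

end

/-!
Dividing `D_k` by the weight two form `u = E₆ / E₄` gives an operator `∇_k` on the field `Mer` which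
preserves weights and satisfies `∇_{k + l} (f g) = ∇_k f * g + f * ∇_l g`. In particular `∇_0`
restricts to a derivation of the field `K` of modular functions, and each `∇_k` is a connection over
it. After division by powers of `u`, an MLDE for `f` of order `n` becomes a `K`-linear dependence
among `f, ∇_k f, …, ∇_k ^ n f` in which the last coefficient is nonzero. Such a dependence exists if
and only if `f` lies in a `∇_k`-stable `K`-subspace `V` of `Mer` of dimension at most `n`: sums are
then handled by `V + W` and products by `V * W`. The meromorphic modular forms of weight `k` are a
stable subspace `L_k` of dimension at most one, and an MLDO of weight `k` maps `V` into `L_k * V`,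
whose dimension does not exceed that of `V`.
-/

namespace MLDO

open Set Submodule

section Connections

variable {K X : Type*} [DivisionRing K] [AddCommGroup X] [Module K X]

/-- A connection on a `K`-vector space along a map `d : K → K` (in practice a derivation): an
additive endomorphism `θ` satisfying the Leibniz rule for scalars. -/
def IsConnection (d : K → K) (θ : X →+ X) : Prop :=
  ∀ (c : K) (x : X), θ (c • x) = d c • x + c • θ x

/-- A `θ`-stable subspace of dimension at most `n`. Bounding `Module.rank` rather than
`Module.finrank` includes finite dimensionality. -/
structure IsStableOfRankLE (θ : X → X) (n : ℕ) (V : Submodule K X) : Prop where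
  rank_le : Module.rank K V ≤ n
  mapsTo : MapsTo θ V V

/-- `x` is D-finite of order at most `n` over `K`: it lies in a `θ`-stable `K`-subspace of dimension
at most `n`. This is the linear-algebra form of solving an equation of order `n`. -/
def IsDFinite (K : Type*) {X : Type*} [DivisionRing K] [AddCommGroup X] [Module K X] (θ : X → X)
    (n : ℕ) (x : X) : Prop :=
  ∃ V : Submodule K X, IsStableOfRankLE θ n V ∧ x ∈ V

variable {d : K → K} {θ : X →+ X} {v : ℕ → X} {n m : ℕ}

theorem mem_span_image_Iio_iff_exists_sum_eq_zero :
    v n ∈ span K (v '' Iio n) ↔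
      ∃ g : ℕ → K, g n ≠ 0 ∧ ∑ i ∈ Finset.range (n + 1), g i • v i = 0 := by
  constructor
  · intro h
    rw [← Finset.coe_range, Finsupp.mem_span_image_iff_linearCombination] at h
    obtain ⟨l, hl, hlv⟩ := h
    rw [Finsupp.linearCombination_apply_of_mem_supported K hl] at hlv
    refine ⟨Function.update l n (-1), by simp, ?_⟩
    have hlt : ∀ i ∈ Finset.range n, Function.update l n (-1) i • v i = l i • v i := fun i hi => by
      rw [Function.update_of_ne (Finset.mem_range.1 hi).ne]
    rw [Finset.sum_range_succ, Finset.sum_congr rfl hlt, hlv]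
    simp
  · rintro ⟨g, hgn, hg⟩
    rw [Finset.sum_range_succ] at hg
    rw [← smul_mem_iff _ hgn, eq_neg_of_add_eq_zero_right hg]
    exact neg_mem (sum_mem fun i hi => smul_mem _ _ (subset_span ⟨i, Finset.mem_range.1 hi, rfl⟩))

theorem exists_le_mem_span_image_Iio {V : Submodule K X} (hV : Module.rank K V ≤ n)
    (hv : ∀ i, v i ∈ V) : ∃ r ≤ n, v r ∈ span K (v '' Iio r) := by
  by_contra! hnot
  have hindep : ∀ m ≤ n + 1, LinearIndepOn K v (Iio m) := fun m hm => by
    induction m with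
    | zero => simp
    | succ m ih =>
      rw [← Order.succ_eq_add_one, Order.Iio_succ_eq_insert]
      exact (ih (by lia)).insert (hnot m (by lia))
  have hindepV : LinearIndepOn K (fun i => (⟨v i, hv i⟩ : V)) (Iio (n + 1)) :=
    LinearIndependent.of_comp V.subtype (hindep _ le_rfl)
  have hcard := hindepV.encard_le_toENat_rank.trans (Cardinal.toENat_le_natCast.2 hV)
  rw [← Finset.coe_range, encard_coe_eq_coe_finsetCard, Finset.card_range, Nat.cast_le] at hcard
  lia

namespace IsConnection

variable (hθ : IsConnection d θ)

include hθ

theorem mapsTo_span {s : Set X} (hs : MapsTo θ s (span K s)) :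
    MapsTo θ (span K s) (span K s) := by
  intro x hx
  induction hx using span_induction with
  | mem x hx => exact hs hx
  | zero => simp
  | add x y _ _ hx hy => simpa using add_mem hx hy
  | smul c x hx h => simpa [hθ c x] using add_mem (smul_mem _ (d c) hx) (smul_mem _ c h)

theorem mapsTo_span_image_Iio (hv : ∀ i, ∃ κ : K, v (i + 1) = θ (v i) + κ • v i)
    (hn : v n ∈ span K (v '' Iio n)) :
    MapsTo θ (span K (v '' Iio n)) (span K (v '' Iio n)) := by
  refine hθ.mapsTo_span ?_
  rintro _ ⟨i, hi, rfl⟩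
  have hsucc : v (i + 1) ∈ span K (v '' Iio n) := by
    obtain rfl | hlt := (Nat.succ_le_of_lt hi).eq_or_lt
    · exact hn
    · exact subset_span ⟨_, hlt, rfl⟩
  obtain ⟨κ, hκ⟩ := hv i
  rw [eq_sub_of_add_eq hκ.symm]
  exact sub_mem hsucc (smul_mem _ _ (subset_span ⟨i, hi, rfl⟩))

theorem isDFinite_iff_exists_sum_eq_zero
    (hv : ∀ i, ∃ κ : K, v (i + 1) = θ (v i) + κ • v i) :
    IsDFinite K θ n (v 0) ↔
      ∃ g : ℕ → K, g n ≠ 0 ∧ ∑ i ∈ Finset.range (n + 1), g i • v i = 0 := by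
  rw [← mem_span_image_Iio_iff_exists_sum_eq_zero]
  have orbit_mem {V : Submodule K X} (hV : MapsTo θ V V) (h0 : v 0 ∈ V) (i : ℕ) : v i ∈ V := by
    induction i with
    | zero => exact h0
    | succ i ih =>
      obtain ⟨κ, hκ⟩ := hv i
      exact hκ ▸ add_mem (hV ih) (smul_mem _ κ ih)
  have zero_mem_span {r : ℕ} (hr : v r ∈ span K (v '' Iio r)) : v 0 ∈ span K (v '' Iio r) := by
    obtain rfl | hpos := r.eq_zero_or_pos
    · exact hr
    · exact subset_span ⟨0, hpos, rfl⟩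
  constructor
  · rintro ⟨V, hV, h0⟩
    obtain ⟨r, hrn, hr⟩ := exists_le_mem_span_image_Iio hV.rank_le (orbit_mem hV.mapsTo h0)
    exact span_mono (image_mono (Iio_subset_Iio hrn))
      (orbit_mem (hθ.mapsTo_span_image_Iio hv hr) (zero_mem_span hr) n)
  · intro hn
    refine ⟨span K (v '' Iio n), ⟨?_, hθ.mapsTo_span_image_Iio hv hn⟩, zero_mem_span hn⟩
    have hcard : Cardinal.mk (v '' Iio n) ≤ n := by
      simpa using Cardinal.mk_image_le_lift (f := v) (s := Iio n)
    exact (rank_span_le _).trans hcard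

end IsConnection

theorem IsStableOfRankLE.sup {V W : Submodule K X} (hV : IsStableOfRankLE θ n V)
    (hW : IsStableOfRankLE θ m W) : IsStableOfRankLE θ (n + m) (V ⊔ W) where
  rank_le := by
    push_cast
    exact (rank_add_le_rank_add_rank V W).trans (add_le_add hV.rank_le hW.rank_le)
  mapsTo x hx := by
    obtain ⟨y, hy, z, hz, rfl⟩ := mem_sup.1 hx
    simpa using add_mem_sup (hV.mapsTo hy) (hW.mapsTo hz)

theorem IsDFinite.add {x y : X} (hx : IsDFinite K θ n x) (hy : IsDFinite K θ m y) :
    IsDFinite K θ (n + m) (x + y) := by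
  obtain ⟨V, hV, hxV⟩ := hx
  obtain ⟨W, hW, hyW⟩ := hy
  exact ⟨V ⊔ W, hV.sup hW, add_mem_sup hxV hyW⟩

end Connections

section Products

variable {K A : Type*} [Field K] [CommRing A] [Algebra K A] {V W : Submodule K A}

theorem rank_mul_le (V W : Submodule K A) :
    Module.rank K ↥(V * W) ≤ Module.rank K V * Module.rank K W := by
  rw [← mulMap_range, ← rank_tensorProduct']
  exact rank_range_le _

theorem mapsTo_mul {F : Type*} [FunLike F A A] [AddMonoidHomClass F A A] {ζ : F} {θ η : A → A}
    (h : ∀ x y, ζ (x * y) = θ x * y + x * η y) (hV : MapsTo θ V V) (hW : MapsTo η W W) :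
    MapsTo ζ (↑(V * W) : Set A) ↑(V * W) := by
  intro z hz
  induction hz using Submodule.mul_induction_on' with
  | mem_mul_mem x hx y hy =>
    rw [h]
    exact add_mem (mul_mem_mul (hV hx) hy) (mul_mem_mul hx (hW hy))
  | add x _ y _ hx hy => simpa using add_mem hx hy

theorem IsStableOfRankLE.mul {ζ : A →+ A} {θ η : A → A} {n m : ℕ}
    (h : ∀ x y, ζ (x * y) = θ x * y + x * η y)
    (hV : IsStableOfRankLE θ n V) (hW : IsStableOfRankLE η m W) :
    IsStableOfRankLE ζ (n * m) (V * W) where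
  rank_le := by
    push_cast
    exact (rank_mul_le V W).trans (mul_le_mul' hV.rank_le hW.rank_le)
  mapsTo := mapsTo_mul h hV.mapsTo hW.mapsTo

theorem IsDFinite.mul {ζ : A →+ A} {θ η : A → A} {n m : ℕ} {x y : A}
    (h : ∀ x y, ζ (x * y) = θ x * y + x * η y)
    (hx : IsDFinite K θ n x) (hy : IsDFinite K η m y) : IsDFinite K ζ (n * m) (x * y) := by
  obtain ⟨V, hV, hxV⟩ := hx
  obtain ⟨W, hW, hyW⟩ := hy
  exact ⟨V * W, hV.mul h hW, mul_mem_mul hxV hyW⟩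

theorem rank_le_one_of_div_mem_range_algebraMap {L : Type*} [Field L] [Algebra K L]
    {V : Submodule K L} (hV : ∀ x ∈ V, ∀ y ∈ V, x / y ∈ range (algebraMap K L)) :
    Module.rank K V ≤ 1 := by
  rw [rank_submodule_le_one_iff']
  by_cases h : ∃ y ∈ V, y ≠ 0
  · obtain ⟨y, hy, hy0⟩ := h
    refine ⟨y, fun x hx => ?_⟩
    obtain ⟨c, hc⟩ := hV x hx y hy
    exact mem_span_singleton.2 ⟨c, by rw [Algebra.smul_def, hc, div_mul_cancel₀ x hy0]⟩
  · push Not at h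
    exact ⟨0, fun x hx => by simp [h x hx]⟩

end Products

end MLDO

noncomputable section

namespace MLDO

open UpperHalfPlane Filter
open scoped ModularForm

section Meromorphic

theorem isPreconnected_upperHalfPlaneSet : IsPreconnected upperHalfPlaneSet :=
  (convex_halfSpace_im_gt 0).isPreconnected

theorem accPt_upperHalfPlaneSet {z : ℂ} (hz : z ∈ upperHalfPlaneSet) :
    AccPt z (𝓟 upperHalfPlaneSet) :=
  accPt_iff_frequently_nhdsNE.2
    (Eventually.frequently (nhdsWithin_le_nhds (isOpen_upperHalfPlaneSet.mem_nhds hz)))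

theorem eventuallyEq_zero_of_mem_nullFun {f : merFun} (hf : f ∈ nullFun) {z : ℂ}
    (hz : z ∈ upperHalfPlaneSet) : (f : ℂ → ℂ) =ᶠ[nhdsWithin z {z}ᶜ] 0 :=
  (f.2 z hz).eventuallyEq_zero_nhdsNE_of_eventuallyEq_zero_codiscreteWithin hz
    (accPt_upperHalfPlaneSet hz) hf

theorem eventually_ne_zero_of_notMem_nullFun {f : merFun} (hf : f ∉ nullFun) :
    ∀ᶠ z in codiscreteWithin upperHalfPlaneSet, (f : ℂ → ℂ) z ≠ 0 := by
  have hmer : MeromorphicOn (f : ℂ → ℂ) upperHalfPlaneSet := f.2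
  refine hmer.eventually_codiscreteWithin_apply_ne_zero ?_
  by_contra! h
  obtain ⟨x, hx, hx_top⟩ := h
  refine hf ?_
  rw [mem_nullFun, EventuallyEq, eventually_iff, mem_codiscreteWithin_iff_forall_mem_nhdsNE]
  intro y hy
  have hy_top : meromorphicOrderAt (f : ℂ → ℂ) y = ⊤ := by
    by_contra hne
    exact hmer.meromorphicOrderAt_ne_top_of_isPreconnected isPreconnected_upperHalfPlaneSet
      hy hx hne hx_top
  filter_upwards [meromorphicOrderAt_eq_top_iff.1 hy_top] with _ hw using Or.inl hw

theorem one_notMem_nullFun : (1 : merFun) ∉ nullFun := fun h => by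
  obtain ⟨_, hw⟩ := (eventuallyEq_zero_of_mem_nullFun h I.im_pos).exists
  exact one_ne_zero hw

instance : nullFun.IsMaximal := by
  refine Ideal.isMaximal_iff.2 ⟨one_notMem_nullFun, fun J f hJ hf hfJ => ?_⟩
  let g : merFun := ⟨(f : ℂ → ℂ)⁻¹, MeromorphicOn.inv f.2⟩
  have hgf : 1 - g * f ∈ nullFun := by
    rw [mem_nullFun]
    filter_upwards [eventually_ne_zero_of_notMem_nullFun hf] with z hz
    simp [g, hz]
  simpa using J.add_mem (hJ hgf) (J.mul_mem_left g hfJ)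

instance : Field Mer := Ideal.Quotient.field nullFun

theorem Mer.ofHol_eq_zero_iff {f : ℍ → ℂ} (hf : MDiff f) : Mer.ofHol f hf = 0 ↔ f = 0 := by
  refine ⟨fun h => ?_, fun h => by subst h; rfl⟩
  rw [Mer.ofHol, Ideal.Quotient.eq_zero_iff_mem] at h
  ext τ
  have hcont : ContinuousAt (f ∘ ofComplex) τ :=
    ((UpperHalfPlane.mdifferentiable_iff.mp hf).differentiableAt
      (isOpen_upperHalfPlaneSet.mem_nhds τ.im_pos)).continuousAt
  have hzero : (f ∘ ofComplex) τ = 0 :=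
    tendsto_nhds_unique (hcont.tendsto.mono_left nhdsWithin_le_nhds)
      (tendsto_const_nhds.congr' (eventuallyEq_zero_of_mem_nullFun h τ.im_pos).symm)
  simpa [ofComplex_apply] using hzero

theorem Mer.deriv_mul (x y : Mer) : Mer.deriv (x * y) = Mer.deriv x * y + x * Mer.deriv y := by
  obtain ⟨f, rfl⟩ := Ideal.Quotient.mk_surjective x
  obtain ⟨g, rfl⟩ := Ideal.Quotient.mk_surjective y
  change Mer.mk (derivFun (f * g)) = Mer.mk (derivFun f * g + f * derivFun g)
  rw [Mer.mk_eq_mk]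
  filter_upwards [deriv_ae f, deriv_ae g] with z hf hg
  simp [derivFun, _root_.deriv_mul hf hg]
  ring

theorem Mer.serre_apply (k : ℝ) (x : Mer) :
    Mer.serre k x = Mer.deriv x - ((k : ℂ) / 12) • (Mer.E2 * x) := rfl

theorem Mer.serre_mul (k l : ℝ) (x y : Mer) :
    Mer.serre (k + l) (x * y) = Mer.serre k x * y + x * Mer.serre l y := by
  simp only [Mer.serre_apply, Mer.deriv_mul, Complex.ofReal_add, add_div, Algebra.smul_def,
    RingHom.map_add]
  ring

theorem Mer.serre_ofHol {f : ℍ → ℂ} (hf : MDiff f) (k : ℝ) :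
    Mer.serre k (Mer.ofHol f hf) = Mer.ofHol (Derivative.serreDerivative k f)
      (Derivative.serreDerivative_mdifferentiable _ hf) := by
  rw [Mer.serre_apply]
  refine Mer.mk_eq_mk.2 ?_
  filter_upwards [self_mem_codiscreteWithin upperHalfPlaneSet] with z hz
  simp [derivFun, Derivative.normalizedDerivOfComplex, ofComplex_apply_of_im_pos hz]
  ring

end Meromorphic

section SerreDerivative

theorem isBoundedAtImInfty_normalizedDerivOfComplex {f : ℍ → ℂ} (hf : MDiff f)
    (hb : IsBoundedAtImInfty f) :
    IsBoundedAtImInfty (Derivative.normalizedDerivOfComplex f) := by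
  rw [isBoundedAtImInfty_iff] at hb ⊢
  obtain ⟨B, A, hBA⟩ := hb
  refine ⟨‖(2 * Real.pi * Complex.I : ℂ)⁻¹‖ * (B / 1), max A 0 + 2, fun z hz => ?_⟩
  have him {w : ℂ} (hw : w ∈ Metric.closedBall (z : ℂ) 1) : max A 0 < w.im := by
    have him_sub := (Complex.abs_im_le_norm (w - z)).trans (mem_closedBall_iff_norm.1 hw)
    rw [Complex.sub_im, coe_im, abs_le] at him_sub
    linarith [him_sub.1]
  have hpos {w : ℂ} (hw : w ∈ Metric.closedBall (z : ℂ) 1) : 0 < w.im :=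
    (le_max_right A 0).trans_lt (him hw)
  rw [Derivative.normalizedDerivOfComplex, norm_mul]
  gcongr
  -- the Cauchy estimate on the unit circle around `z`
  refine Complex.norm_deriv_le_of_forall_mem_sphere_norm_le one_pos
    (DifferentiableOn.diffContOnCl_ball (UpperHalfPlane.mdifferentiable_iff.mp hf)
      fun w hw => hpos hw) fun w hw => ?_
  replace hw := Metric.sphere_subset_closedBall hw
  rw [Function.comp_apply, ofComplex_apply_of_im_pos (hpos hw)]
  exact hBA _ ((le_max_left A 0).trans (him hw).le)

theorem isBoundedAtImInfty_serreDerivative {f : ℍ → ℂ} (hf : MDiff f)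
    (hb : IsBoundedAtImInfty f) (k : ℂ) :
    IsBoundedAtImInfty (Derivative.serreDerivative k f) :=
  (isBoundedAtImInfty_normalizedDerivOfComplex hf hb).sub
    (((const_boundedAtFilter atImInfty (k * 12⁻¹)).mul
      EisensteinSeries.isBoundedAtImInfty_E2).mul hb)

theorem serreDerivative_slash {n : ℤ} (f : ModularForm 𝒮ℒ n) (γ : SL(2, ℤ)) :
    Derivative.serreDerivative n f ∣[(n + 2 : ℤ)] γ = Derivative.serreDerivative n f :=
  Derivative.serreDerivative_slash_invariant f.holo' (f.slash_action_eq' _ ⟨γ, rfl⟩)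

/-- The Serre derivative of a level one modular form, as a modular form. -/
def serreForm {n : ℤ} (f : ModularForm 𝒮ℒ n) : ModularForm 𝒮ℒ (n + 2) where
  toFun := Derivative.serreDerivative n f
  slash_action_eq' := by
    rintro _ ⟨γ, rfl⟩
    exact serreDerivative_slash f γ
  holo' := Derivative.serreDerivative_mdifferentiable _ f.holo'
  bdd_at_cusps' {c} hc := by
    rw [Subgroup.IsArithmetic.isCusp_iff_isCusp_SL2Z] at hc
    refine (OnePoint.isBoundedAt_iff_forall_SL2Z hc).2 fun γ _ => ?_
    rw [serreDerivative_slash]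
    exact isBoundedAtImInfty_serreDerivative f.holo' (ModularFormClass.bdd_at_infty f) _

end SerreDerivative

section ModularForms

theorem coeff_wt_self (f : Mer) (k : ℝ) : (wt f k).coeff k = f := by
  rw [AddMonoidAlgebra.coeff_single, Finsupp.single_eq_same]

theorem wt_mul_wt (f g : Mer) (k l : ℝ) : wt f k * wt g l = wt (f * g) (k + l) :=
  AddMonoidAlgebra.single_mul_single ..

theorem coeff_delta (φ : M) (k : ℝ) : (delta φ).coeff (k + 2) = Mer.serre k (φ.coeff k) := by
  induction φ using AddMonoidAlgebra.induction_linear with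
  | zero => simp
  | add φ ψ hφ hψ => simp [hφ, hψ]
  | single l f =>
    rw [← wt, delta_wt]
    by_cases h : l = k
    · subst h
      simp
    · simp [Finsupp.single_eq_of_ne, Ne.symm h]

variable {f g : Mer} {k l : ℝ}

theorem wt_ofHol_mem_modForms {n : ℤ} (f : ModularForm 𝒮ℒ n) (hn : Even n) :
    wt (Mer.ofHol f f.holo') n ∈ modForms :=
  Submodule.subset_span ⟨n, hn, f, rfl⟩

theorem one_mem_modForms : (1 : M) ∈ modForms :=
  Submodule.subset_span ⟨0, Even.zero, 1, by rw [Int.cast_zero]; rfl⟩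

theorem mul_mem_modForms {φ ψ : M} (hφ : φ ∈ modForms) (hψ : ψ ∈ modForms) :
    φ * ψ ∈ modForms := by
  induction hφ, hψ using Submodule.span_induction₂ with
  | mem_mem φ ψ hφ hψ =>
    obtain ⟨n, hn, f, rfl⟩ := hφ
    obtain ⟨m, hm, g, rfl⟩ := hψ
    rw [wt_mul_wt, ← Int.cast_add]
    exact wt_ofHol_mem_modForms (f.mul g) (hn.add hm)
  | zero_left | zero_right => simp
  | add_left _ _ _ _ _ _ h₁ h₂ => simpa only [add_mul] using add_mem h₁ h₂
  | add_right _ _ _ _ _ _ h₁ h₂ => simpa only [mul_add] using add_mem h₁ h₂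
  | smul_left c _ _ _ _ h => simpa only [smul_mul_assoc] using Submodule.smul_mem _ c h
  | smul_right c _ _ _ _ h => simpa only [mul_smul_comm] using Submodule.smul_mem _ c h

theorem delta_mem_modForms {φ : M} (hφ : φ ∈ modForms) : delta φ ∈ modForms := by
  induction hφ using Submodule.span_induction with
  | mem φ hφ =>
    obtain ⟨n, hn, f, rfl⟩ := hφ
    rw [delta_wt, Mer.serre_ofHol]
    exact_mod_cast wt_ofHol_mem_modForms (serreForm f) (hn.add even_two)
  | zero => simp
  | add φ ψ _ _ hφ hψ => simpa only [map_add] using add_mem hφ hψ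
  | smul c φ _ hφ => simpa only [map_smul] using Submodule.smul_mem _ c hφ

theorem wt_coeff_mem_modForms {φ : M} (hφ : φ ∈ modForms) (s : ℝ) :
    wt (φ.coeff s) s ∈ modForms := by
  induction hφ using Submodule.span_induction with
  | mem φ hφ =>
    obtain ⟨n, hn, f, rfl⟩ := hφ
    by_cases h : (n : ℝ) = s
    · subst h
      rw [coeff_wt_self]
      exact wt_ofHol_mem_modForms f hn
    · simp [Finsupp.single_eq_of_ne, Ne.symm h]
  | zero => simp
  | add φ ψ _ _ hφ hψ => simpa using add_mem hφ hψ
  | smul c φ _ hφ => simpa using Submodule.smul_mem _ c hφ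

theorem wt_mem_merForms_iff :
    wt f k ∈ merForms ↔
      ∃ (b : Mer) (n : ℝ), b ≠ 0 ∧ wt b n ∈ modForms ∧ wt (f * b) (k + n) ∈ modForms := by
  constructor
  · rintro ⟨_, hf, _, hg, ⟨n, b, rfl⟩, hb, rfl⟩
    exact ⟨b, n, fun h => hb (by simp [h]), hg, wt_mul_wt f b k n ▸ hf⟩
  · rintro ⟨b, n, hb, hbn, hfb⟩
    exact ⟨_, hfb, _, hbn, ⟨n, b, rfl⟩, by simpa using hb, wt_mul_wt f b k n⟩

theorem wt_mem_merForms_of_mem_modForms (hf : wt f k ∈ modForms) : wt f k ∈ merForms :=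
  wt_mem_merForms_iff.2 ⟨1, 0, one_ne_zero, one_mem_modForms, by simpa using hf⟩

theorem wt_coeff_mem_merForms {φ : M} (hφ : φ ∈ merForms) (s : ℝ) :
    wt (φ.coeff s) s ∈ merForms := by
  obtain ⟨ψ, hψ, _, hg, ⟨n, b, rfl⟩, hb, hφψ⟩ := hφ
  refine wt_mem_merForms_iff.2 ⟨b, n, fun h => hb (by simp [h]), hg, ?_⟩
  rw [← AddMonoidAlgebra.coeff_mul_single_add φ, hφψ]
  exact wt_coeff_mem_modForms hψ (s + n)

theorem wt_algebraMap_mem_merForms (c : ℂ) : wt (algebraMap ℂ Mer c) 0 ∈ merForms := by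
  refine wt_mem_merForms_of_mem_modForms ?_
  have h := modForms.smul_mem c one_mem_modForms
  rwa [AddMonoidAlgebra.one_def, AddMonoidAlgebra.smul_single, Algebra.smul_def, mul_one] at h

theorem wt_add_mem_merForms (hf : wt f k ∈ merForms) (hg : wt g k ∈ merForms) :
    wt (f + g) k ∈ merForms := by
  rw [wt_mem_merForms_iff] at *
  obtain ⟨a, n, ha, han, hfa⟩ := hf
  obtain ⟨b, m, hb, hbm, hgb⟩ := hg
  refine ⟨a * b, n + m, mul_ne_zero ha hb, wt_mul_wt a b n m ▸ mul_mem_modForms han hbm, ?_⟩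
  convert add_mem (mul_mem_modForms hfa hbm) (mul_mem_modForms hgb han) using 1
  rw [wt_mul_wt, wt_mul_wt, add_assoc k m n, add_comm m n, ← add_assoc k n m,
    ← AddMonoidAlgebra.single_add]
  congr 1
  ring

theorem wt_mul_mem_merForms (hf : wt f k ∈ merForms) (hg : wt g l ∈ merForms) :
    wt (f * g) (k + l) ∈ merForms := by
  rw [wt_mem_merForms_iff] at *
  obtain ⟨a, n, ha, han, hfa⟩ := hf
  obtain ⟨b, m, hb, hbm, hgb⟩ := hg
  refine ⟨a * b, n + m, mul_ne_zero ha hb, wt_mul_wt a b n m ▸ mul_mem_modForms han hbm, ?_⟩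
  convert mul_mem_modForms hfa hgb using 1
  rw [wt_mul_wt, add_add_add_comm, mul_mul_mul_comm]

theorem wt_zero_mem_merForms (k : ℝ) : wt 0 k ∈ merForms :=
  wt_mem_merForms_of_mem_modForms (by simp)

theorem wt_inv_mem_merForms (hf : wt f k ∈ merForms) : wt f⁻¹ (-k) ∈ merForms := by
  obtain rfl | hf0 := eq_or_ne f 0
  · simpa using wt_zero_mem_merForms (-k)
  rw [wt_mem_merForms_iff] at *
  obtain ⟨b, n, hb, hbn, hfb⟩ := hf
  refine ⟨f * b, k + n, mul_ne_zero hf0 hb, hfb, ?_⟩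
  rwa [inv_mul_cancel_left₀ hf0, neg_add_cancel_left]

theorem wt_serre_mem_merForms (hf : wt f k ∈ merForms) :
    wt (Mer.serre k f) (k + 2) ∈ merForms := by
  rw [wt_mem_merForms_iff] at *
  obtain ⟨b, n, hb, hbn, hfb⟩ := hf
  refine ⟨b * b, n + n, mul_ne_zero hb hb, wt_mul_wt b b n n ▸ mul_mem_modForms hbn hbn, ?_⟩
  -- the quotient rule `D f * b ^ 2 = D (f * b) * b - (f * b) * D b`
  convert sub_mem (mul_mem_modForms (delta_mem_modForms hfb) hbn)
    (mul_mem_modForms hfb (delta_mem_modForms hbn)) using 1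
  rw [delta_wt, delta_wt, wt_mul_wt, wt_mul_wt, Mer.serre_mul,
    show k + n + 2 + n = k + 2 + (n + n) by ring, show k + n + (n + 2) = k + 2 + (n + n) by ring,
    ← AddMonoidAlgebra.single_sub]
  congr 1
  ring

end ModularForms

section ModularFunctions

/-- The field of modular functions, that is, of meromorphic modular forms of weight zero. -/
def modFunField : Subfield Mer where
  carrier := {x | wt x 0 ∈ merForms}
  mul_mem' hx hy := by simpa using wt_mul_mem_merForms hx hy
  add_mem' hx hy := wt_add_mem_merForms hx hy
  one_mem' := wt_mem_merForms_of_mem_modForms one_mem_modForms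
  zero_mem' := wt_zero_mem_merForms 0
  neg_mem' {x} hx := by
    have h := wt_mul_mem_merForms (wt_algebraMap_mem_merForms (-1)) hx
    rwa [zero_add, RingHom.map_neg, RingHom.map_one, neg_one_mul] at h
  inv_mem' x hx := by simpa using wt_inv_mem_merForms hx

/-- The meromorphic modular forms of weight `k`, as a vector space over the modular functions. -/
def ratForms (k : ℝ) : Submodule modFunField Mer where
  carrier := {x | wt x k ∈ merForms}
  add_mem' hx hy := wt_add_mem_merForms hx hy
  zero_mem' := wt_zero_mem_merForms k
  smul_mem' c x hx := by simpa [Subfield.smul_def] using wt_mul_mem_merForms c.2 hx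

variable {f g : Mer} {k l : ℝ}

theorem mem_modFunField : f ∈ modFunField ↔ f ∈ ratForms 0 := Iff.rfl

theorem mul_mem_ratForms (hf : f ∈ ratForms k) (hg : g ∈ ratForms l) :
    f * g ∈ ratForms (k + l) :=
  wt_mul_mem_merForms hf hg

theorem inv_mem_ratForms (hf : f ∈ ratForms k) : f⁻¹ ∈ ratForms (-k) :=
  wt_inv_mem_merForms hf

theorem serre_mem_ratForms (hf : f ∈ ratForms k) : Mer.serre k f ∈ ratForms (k + 2) :=
  wt_serre_mem_merForms hf

theorem one_mem_ratForms : 1 ∈ ratForms 0 :=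
  mem_modFunField.1 (one_mem modFunField)

theorem div_mem_modFunField (hf : f ∈ ratForms k) (hg : g ∈ ratForms k) :
    f / g ∈ modFunField := by
  rw [mem_modFunField, div_eq_mul_inv, ← add_neg_cancel k]
  exact mul_mem_ratForms hf (inv_mem_ratForms hg)

theorem pow_mem_ratForms (hf : f ∈ ratForms k) (n : ℕ) : f ^ n ∈ ratForms (n * k) := by
  induction n with
  | zero => simpa using one_mem_ratForms
  | succ n ih =>
    rw [pow_succ, Nat.cast_add_one, add_one_mul]
    exact mul_mem_ratForms ih hf

theorem ratForms_mul_ratForms_le (k l : ℝ) :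
    ratForms k * ratForms l ≤ ratForms (k + l) :=
  Submodule.mul_le.2 fun _ hf _ hg => mul_mem_ratForms hf hg

end ModularFunctions

section Normalization

/-- The form `E₆ / E₄`, a nonzero meromorphic modular form of weight two. Dividing by it turns the
weight-raising operators `Mer.serre k` into endomorphisms `conn k` of `Mer`. -/
def weightTwo : Mer :=
  Mer.ofHol ModularForm.E₆ ModularForm.E₆.holo' / Mer.ofHol ModularForm.E₄ ModularForm.E₄.holo'

theorem weightTwo_mem_ratForms : weightTwo ∈ ratForms 2 := by
  have h₄ := wt_mem_merForms_of_mem_modForms (wt_ofHol_mem_modForms ModularForm.E₄ (by decide))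
  have h₆ := wt_mem_merForms_of_mem_modForms (wt_ofHol_mem_modForms ModularForm.E₆ (by decide))
  rw [weightTwo, div_eq_mul_inv, show (2 : ℝ) = (6 : ℤ) + -(4 : ℤ) by norm_num]
  exact mul_mem_ratForms h₆ (inv_mem_ratForms h₄)

theorem ofHol_E_ne_zero {k : ℕ} (hk : 3 ≤ k) (hk2 : Even k) :
    Mer.ofHol (ModularForm.E hk) (ModularForm.E hk).holo' ≠ 0 := fun h =>
  EisensteinSeries.E_ne_zero hk hk2 (DFunLike.coe_injective ((Mer.ofHol_eq_zero_iff _).1 h))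

theorem weightTwo_ne_zero : weightTwo ≠ 0 :=
  div_ne_zero (ofHol_E_ne_zero (by norm_num) (by decide))
    (ofHol_E_ne_zero (by norm_num) (by decide))

theorem weightTwo_pow_mem_ratForms (n : ℕ) : weightTwo ^ n ∈ ratForms (2 * n) := by
  rw [mul_comm]
  exact pow_mem_ratForms weightTwo_mem_ratForms n

/-- The Ramanujan–Serre operator of weight `k`, normalized to preserve the weight. -/
def conn (k : ℝ) : Mer →+ Mer :=
  (AddMonoidHom.mulLeft weightTwo⁻¹).comp (Mer.serre k).toAddMonoidHom

variable {f g : Mer} {k l : ℝ}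

theorem conn_apply (k : ℝ) (f : Mer) : conn k f = weightTwo⁻¹ * Mer.serre k f := rfl

theorem serre_eq_weightTwo_mul_conn (k : ℝ) (f : Mer) : Mer.serre k f = weightTwo * conn k f := by
  rw [conn_apply, mul_inv_cancel_left₀ weightTwo_ne_zero]

theorem conn_mul (k l : ℝ) (f g : Mer) :
    conn (k + l) (f * g) = conn k f * g + f * conn l g := by
  simp only [conn_apply, Mer.serre_mul]
  ring

theorem mapsTo_conn_ratForms (k : ℝ) : Set.MapsTo (conn k) (ratForms k) (ratForms k) := by
  intro f hf
  simpa [conn_apply] using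
    mul_mem_ratForms (inv_mem_ratForms weightTwo_mem_ratForms) (serre_mem_ratForms hf)

theorem isStableOfRankLE_ratForms (k : ℝ) : IsStableOfRankLE (conn k) 1 (ratForms k) where
  rank_le := Nat.cast_one (R := Cardinal) ▸ rank_le_one_of_div_mem_range_algebraMap fun f hf g hg =>
    ⟨⟨f / g, div_mem_modFunField hf hg⟩, rfl⟩
  mapsTo := mapsTo_conn_ratForms k

/-- The derivation of the field of modular functions obtained by restricting `conn 0`. -/
def modFunDeriv (c : modFunField) : modFunField := ⟨conn 0 c, mapsTo_conn_ratForms 0 c.2⟩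

theorem isConnection_conn (k : ℝ) : IsConnection modFunDeriv (conn k) := fun c f => by
  have h := conn_mul 0 k c f
  rwa [zero_add] at h

/-- The logarithmic derivative `∇ (u ^ i) / u ^ i` of a power of the weight two form `u`. -/
def twist (i : ℕ) : modFunField :=
  ⟨conn (2 * i) (weightTwo ^ i) / weightTwo ^ i, div_mem_modFunField
    (mapsTo_conn_ratForms _ (weightTwo_pow_mem_ratForms i)) (weightTwo_pow_mem_ratForms i)⟩

/-- The iterates of `δ` on `f` in weight `k`, divided by powers of the weight two form so that
all of them have weight `k`. -/
def normIter (k : ℝ) (f : Mer) : ℕ → Mer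
  | 0 => f
  | i + 1 => conn k (normIter k f i) + twist i • normIter k f i

theorem serre_weightTwo_pow_mul (k : ℝ) (i : ℕ) (f : Mer) :
    Mer.serre (k + 2 * i) (weightTwo ^ i * f) =
      weightTwo ^ (i + 1) * (conn k f + twist i • f) := by
  have hu : weightTwo ^ i ≠ 0 := pow_ne_zero i weightTwo_ne_zero
  rw [serre_eq_weightTwo_mul_conn, add_comm k, conn_mul]
  change _ = _ * (conn k f + conn (2 * i) (weightTwo ^ i) / weightTwo ^ i * f)
  field_simp
  ring

theorem delta_pow_wt (k : ℝ) (f : Mer) (i : ℕ) :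
    (delta ^ i) (wt f k) = wt (weightTwo ^ i * normIter k f i) (k + 2 * i) := by
  induction i with
  | zero => simp [normIter]
  | succ i ih =>
    rw [pow_succ', Module.End.mul_apply, ih, delta_wt, serre_weightTwo_pow_mul, normIter,
      Nat.cast_add_one, mul_add_one, add_assoc]

end Normalization

section Solutions

variable {f : Mer} {k : ℝ} {n : ℕ}

theorem sum_mulLeft_mul_delta_pow_wt (c : ℕ → M) (n : ℕ) (f : Mer) (k : ℝ) :
    (∑ i ∈ Finset.range n, LinearMap.mulLeft ℂ (c i) * delta ^ i) (wt f k) =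
      ∑ i ∈ Finset.range n, c i * wt (weightTwo ^ i * normIter k f i) (k + 2 * i) := by
  simp only [LinearMap.sum_apply, Module.End.mul_apply, delta_pow_wt, LinearMap.mulLeft_apply]

theorem delta_mem_merMLDO : delta ∈ merMLDO :=
  Algebra.subset_adjoin (Or.inl rfl)

theorem mulLeft_mem_merMLDO {c : M} (hc : c ∈ merForms) : LinearMap.mulLeft ℂ c ∈ merMLDO :=
  Algebra.subset_adjoin (Or.inr ⟨c, hc, rfl⟩)

theorem sum_mulLeft_mul_delta_pow_mem_merMLDO {c : ℕ → M} (hc : ∀ i, c i ∈ merForms) (n : ℕ) :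
    (∑ i ∈ Finset.range n, LinearMap.mulLeft ℂ (c i) * delta ^ i) ∈ merMLDO :=
  sum_mem fun i _ => mul_mem (mulLeft_mem_merMLDO (hc i)) (pow_mem delta_mem_merMLDO i)

theorem exists_sum_normIter_eq_zero_of_wt_mem_sol (h : wt f k ∈ sol n k) :
    ∃ g : ℕ → modFunField, g n ≠ 0 ∧
      ∑ i ∈ Finset.range (n + 1), g i • normIter k f i = 0 := by
  obtain ⟨-, _, ⟨-, c, hc, hcn, rfl⟩, ha⟩ := h
  obtain ⟨s, hs⟩ : ∃ s, (c n).coeff s ≠ 0 := by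
    by_contra! h0
    exact hcn (AddMonoidAlgebra.ext (Finsupp.ext h0))
  have hmem (i : ℕ) : (c i).coeff (s + 2 * n - 2 * i) * weightTwo ^ i ∈ ratForms (s + 2 * n) := by
    have h := mul_mem_ratForms (wt_coeff_mem_merForms (hc i) (s + 2 * n - 2 * i))
      (weightTwo_pow_mem_ratForms i)
    rwa [sub_add_cancel] at h
  refine ⟨fun i => ⟨_, div_mem_modFunField (hmem i) (hmem n)⟩, ?_, ?_⟩
  · rw [Ne, ← ZeroMemClass.coe_eq_zero]
    simp [hs, weightTwo_ne_zero]
  · -- the component of weight `s + 2 * n + k` of the differential equation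
    have hcoeff := congrArg (fun φ : M => φ.coeff (s + 2 * n + k)) ha
    have hterm (i : ℕ) : (c i * wt (weightTwo ^ i * normIter k f i) (k + 2 * i)).coeff
        (s + 2 * n + k) =
          (c i).coeff (s + 2 * n - 2 * i) * (weightTwo ^ i * normIter k f i) := by
      rw [← AddMonoidAlgebra.coeff_mul_single_add]
      congr 1
      ring
    simp only [sum_mulLeft_mul_delta_pow_wt, AddMonoidAlgebra.coeff_sum, Finsupp.finsetSum_apply,
      hterm, AddMonoidAlgebra.coeff_zero, Finsupp.zero_apply] at hcoeff
    simp only [Subfield.smul_def, smul_eq_mul, div_mul_eq_mul_div, mul_assoc,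
      ← Finset.sum_div]
    rw [hcoeff, zero_div]

theorem wt_mem_sol_of_sum_normIter_eq_zero {g : ℕ → modFunField} (hgn : g n ≠ 0)
    (hg : ∑ i ∈ Finset.range (n + 1), g i • normIter k f i = 0) : wt f k ∈ sol n k := by
  set c : ℕ → M := fun i => wt (g i * (weightTwo ^ i)⁻¹) (-(2 * i))
  have hc (i : ℕ) : c i ∈ merForms := by
    simpa [c] using wt_mul_mem_merForms (g i).2 (inv_mem_ratForms (weightTwo_pow_mem_ratForms i))
  have hterm (i : ℕ) : c i * wt (weightTwo ^ i * normIter k f i) (k + 2 * i) =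
      wt (g i • normIter k f i) k := by
    rw [wt_mul_wt, mul_assoc, inv_mul_cancel_left₀ (pow_ne_zero i weightTwo_ne_zero),
      neg_add_cancel_comm_assoc]
    rfl
  refine ⟨⟨f, rfl⟩, _, ⟨sum_mulLeft_mul_delta_pow_mem_merMLDO hc (n + 1), c, hc, ?_, rfl⟩, ?_⟩
  · simp [c, hgn, weightTwo_ne_zero]
  · simp only [sum_mulLeft_mul_delta_pow_wt, hterm]
    have hwt := congrArg (AddMonoidAlgebra.singleAddHom k) hg
    rwa [map_sum, map_zero] at hwt

theorem wt_mem_sol_iff : wt f k ∈ sol n k ↔ IsDFinite modFunField (conn k) n f := by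
  refine Iff.trans ⟨exists_sum_normIter_eq_zero_of_wt_mem_sol, ?_⟩
    ((isConnection_conn k).isDFinite_iff_exists_sum_eq_zero (v := normIter k f)
      fun i => ⟨twist i, rfl⟩).symm
  rintro ⟨g, hgn, hg⟩
  exact wt_mem_sol_of_sum_normIter_eq_zero hgn hg

end Solutions

section Operators

variable {a : Module.End ℂ M} {V : Submodule modFunField Mer} {f : Mer} {l : ℝ} {m : ℕ}

/-- The graded subgroup of `M` spanned by the products of meromorphic modular forms with elements of
`V` placed in weight `l`. -/
def gradedSpan (V : Submodule modFunField Mer) (l : ℝ) : AddSubgroup M where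
  carrier := {φ | ∀ s, φ.coeff (s + l) ∈ ratForms s * V}
  add_mem' hφ hψ s := add_mem (hφ s) (hψ s)
  zero_mem' _ := zero_mem _
  neg_mem' hφ s := neg_mem (hφ s)

theorem wt_mem_gradedSpan (hf : f ∈ V) : wt f l ∈ gradedSpan V l := by
  intro s
  obtain rfl | hs := eq_or_ne s 0
  · simpa using Submodule.mul_mem_mul one_mem_ratForms hf
  · simp [Finsupp.single_eq_of_ne, hs]

theorem mul_mem_ratForms_mul {s t : ℝ} {x y : Mer} (hx : x ∈ ratForms s)
    (hy : y ∈ ratForms t * V) : x * y ∈ ratForms (s + t) * V := by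
  refine mul_le_mul' (ratForms_mul_ratForms_le s t) le_rfl ?_
  rw [mul_assoc]
  exact Submodule.mul_mem_mul hx hy

theorem mul_mem_gradedSpan {c φ : M} (hc : c ∈ merForms) (hφ : φ ∈ gradedSpan V l) :
    c * φ ∈ gradedSpan V l := by
  rw [← c.sum_coeff_single, Finsupp.sum, Finset.sum_mul]
  refine sum_mem fun t _ s => ?_
  have h := mul_mem_ratForms_mul (wt_coeff_mem_merForms hc t) (hφ (s - t))
  rwa [← AddMonoidAlgebra.coeff_single_mul_add, add_sub_cancel,
    show t + (s - t + l) = s + l by ring] at h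

theorem delta_mem_gradedSpan (hV : Set.MapsTo (conn l) V V) {φ : M} (hφ : φ ∈ gradedSpan V l) :
    delta φ ∈ gradedSpan V l := by
  intro s
  have hconn := mapsTo_mul (conn_mul (s - 2) l) (mapsTo_conn_ratForms (s - 2)) hV (hφ (s - 2))
  have hserre := mul_mem_ratForms_mul weightTwo_mem_ratForms hconn
  rwa [← serre_eq_weightTwo_mul_conn, ← coeff_delta, add_sub_cancel,
    show s - 2 + l + 2 = s + l by ring] at hserre

theorem apply_mem_gradedSpan (ha : a ∈ merMLDO) (hV : Set.MapsTo (conn l) V V) {φ : M}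
    (hφ : φ ∈ gradedSpan V l) : a φ ∈ gradedSpan V l := by
  induction ha using Algebra.adjoin_induction generalizing φ with
  | mem _ ha =>
    obtain rfl | ⟨c, hc, rfl⟩ := ha
    · exact delta_mem_gradedSpan hV hφ
    · exact mul_mem_gradedSpan hc hφ
  | algebraMap z =>
    rw [Module.algebraMap_end_apply, Algebra.smul_def]
    exact mul_mem_gradedSpan (wt_algebraMap_mem_merForms z) hφ
  | add _ _ _ _ ha hb => exact add_mem (ha hφ) (hb hφ)
  | mul _ _ _ _ ha hb => exact ha (hb hφ)

theorem IsDFinite.coeff_apply_wt (hf : IsDFinite modFunField (conn l) m f) (ha : a ∈ merMLDO)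
    (k : ℝ) : IsDFinite modFunField (conn (k + l)) m ((a (wt f l)).coeff (k + l)) := by
  obtain ⟨V, hV, hfV⟩ := hf
  exact ⟨ratForms k * V, one_mul m ▸ (isStableOfRankLE_ratForms k).mul (conn_mul k l) hV,
    apply_mem_gradedSpan ha hV.mapsTo (wt_mem_gradedSpan hfV) k⟩

end Operators

end MLDO

end

theorem mainTheorem8 :
    (∀ (n m : ℕ) (k : ℝ), MLDO.sol n k + MLDO.sol m k ⊆ MLDO.sol (n + m) k) ∧
    (∀ (n m : ℕ) (k l : ℝ), MLDO.sol n k * MLDO.sol m l ⊆ MLDO.sol (n * m) (k + l)) ∧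
    (∀ (m : ℕ) (k l : ℝ), ∀ a ∈ MLDO.merMLDOWt k, ∀ φ ∈ MLDO.sol m l,
      a φ ∈ MLDO.sol m (k + l)) ∧
    (∀ k : ℝ, MLDO.merFormsWt k ⊆ MLDO.sol 1 k) := by
  open MLDO in
  refine ⟨fun n m k => ?_, fun n m k l => ?_, fun m k l a ha φ hφ => ?_, fun k φ hφ => ?_⟩
  · rintro _ ⟨_, hf, _, hg, rfl⟩
    obtain ⟨f, rfl⟩ := hf.1
    obtain ⟨g, rfl⟩ := hg.1
    simp only [← AddMonoidAlgebra.single_add, wt_mem_sol_iff] at hf hg ⊢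
    exact hf.add hg
  · rintro _ ⟨_, hf, _, hg, rfl⟩
    obtain ⟨f, rfl⟩ := hf.1
    obtain ⟨g, rfl⟩ := hg.1
    simp only [wt_mul_wt, wt_mem_sol_iff] at hf hg ⊢
    exact hf.mul (conn_mul k l) hg
  · obtain ⟨f, rfl⟩ := hφ.1
    have hcoeff := (wt_mem_sol_iff.1 hφ).coeff_apply_wt ha.1 k
    obtain ⟨h, hh⟩ := ha.2 l _ hφ.1
    rw [hh, add_comm l k] at hcoeff ⊢
    rw [coeff_wt_self] at hcoeff
    exact wt_mem_sol_iff.2 hcoeff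
  · obtain ⟨hφ, f, rfl⟩ := hφ
    exact wt_mem_sol_iff.2 ⟨ratForms k, isStableOfRankLE_ratForms k, hφ⟩
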